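/- **Model.** Fix $d\ge 1$ and a set $U$ of admissible input points with $\mathbb Z^d\subseteq U\subseteq\mathbb R^d$ (for instance $U=\mathbb Z^d$ or $U=\mathbb R^d$). For points $x_1,\dots,x_n\in\mathbb R^d$ and $k$ centers $C=(c_1,\dots,c_k)$ in $\mathbb R^d$, let $\operatorname{dist}(p,C)=\min_i\|p-c_i\|_2$ and $$V_n(C)=\sum_{i=1}^n\operatorname{dist}(x_i,C)\ \ (k\text{-median}),\qquad V_n(C)=\sum_{i=1}^n\operatorname{dist}(x_i,C)^2\ \ (k\text{-means}),\qquad \mathrm{OPT}_n=\inf_C V_n(C).$$ A randomized one-pass streaming algorithm reads the points of an infinite stream $x_1,x_2,\dots$ one after the other. Its memory content is a bit string, which after each new point is replaced by a function of the old memory content, the new point, the step number and the random coins, and its solution $s^{(n)}$ (a $k$-tuple of centers) is a function of the memory content after $n$ points, of $n$ and of the coins. The random coins are not charged to the memory. The algorithm is asymptotically exact with failure probability $\delta$ if for every infinite stream of points of $U$ for which $\mathrm{OPT}_n>0$ for some $n$ (and hence for all larger $n$), with probability at least $1-\delta$, $$\frac{V_n(s^{(n)})}{\mathrm{OPT}_n}\xrightarrow{n\to\infty}1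 .$$ It uses at most $s$ bits of memory on inputs of length $n$ if on every stream of $n$ points of the grid $\{1,\dots,n\}^d$, almost surely, its memory content has length at most $s$ after each of the steps $0,1,\dots,n$. **Theorem.** Let $0<\delta<1/2$. There are $c>0$ and $n_0\in\mathbb N$, depending only on $\delta$, such that for every $d\ge 1$, every $k$ and every $U$ with $\mathbb Z^d\subseteq U\subseteq\mathbb R^d$ the following holds. 1. If $k\ge 2$, every streaming algorithm for $k$-median that is asymptotically exact with failure probability $\delta$ uses $\Omega(n)$ memory: if $n\ge n_0$ and it uses at most $s$ bits of memory on inputs of length $n$, then $s\ge c\,n$. 2. If $k\ge 3$, the same holds for every streaming algorithm for $k$-means that is asymptotically exact with failure probability $\delta$. -/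

import Mathlib

open Filter MeasureTheory Topology

noncomputable section

/-- `dist(p, C) = min_{c ∈ C} dist(p, c)` for the Euclidean distance in `ℝ^d`, where the set `C` of
`k` centers is listed as `C 0, …, C (k - 1)`. -/
def distToCenters {d k : ℕ} (p : EuclideanSpace ℝ (Fin d)) (C : Fin k → EuclideanSpace ℝ (Fin d)) :
    ℝ :=
  ⨅ i, dist p (C i)

/-- The `k`-median objective on the first `n` points of the stream `x`. -/
def kMedianCost (d k : ℕ) (x : ℕ → EuclideanSpace ℝ (Fin d)) (n : ℕ)
    (C : Fin k → EuclideanSpace ℝ (Fin d)) : ℝ :=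
  ∑ i ∈ Finset.range n, distToCenters (x i) C

/-- The `k`-means objective on the first `n` points of the stream `x`. -/
def kMeansCost (d k : ℕ) (x : ℕ → EuclideanSpace ℝ (Fin d)) (n : ℕ)
    (C : Fin k → EuclideanSpace ℝ (Fin d)) : ℝ :=
  ∑ i ∈ Finset.range n, distToCenters (x i) C ^ 2

/-- The optimal value of an objective `V` on the first `n` points of the stream `x`. -/
def optCost {d k : ℕ}
    (V : (ℕ → EuclideanSpace ℝ (Fin d)) → ℕ → (Fin k → EuclideanSpace ℝ (Fin d)) → ℝ)
    (x : ℕ → EuclideanSpace ℝ (Fin d)) (n : ℕ) : ℝ :=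
  ⨅ C : Fin k → EuclideanSpace ℝ (Fin d), V x n C

/-- The points of `ℝ^d` with integer coordinates. -/
def integerPoints (d : ℕ) : Set (EuclideanSpace ℝ (Fin d)) :=
  {p | ∀ j, ∃ m : ℤ, p j = (m : ℝ)}

/-- A randomized one-pass streaming algorithm that reads points of `ℝ^d` and maintains `k` centers.
Its memory content is a bit string. The element `ω` of the sample space `Ω` is the outcome of all
coin tosses. The coins are not charged to the memory, and the step number `t` tells which of them
are used in that step. -/
structure StreamingAlgorithm (Ω : Type*) [MeasurableSpace Ω] (d k : ℕ) where
  /-- The memory content before the first point is read. -/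
  init : Ω → List Bool
  /-- The new memory content when the point number `t` is read. -/
  update : Ω → ℕ → List Bool → EuclideanSpace ℝ (Fin d) → List Bool
  /-- The solution reported after `t` points have been read. -/
  output : Ω → ℕ → List Bool → Fin k → EuclideanSpace ℝ (Fin d)
  measurable_init : ∀ τ, MeasurableSet {ω | init ω = τ}
  measurable_update : ∀ t σ p τ, MeasurableSet {ω | update ω t σ p = τ}
  measurable_output : ∀ t σ, Measurable fun ω => output ω t σ

namespace StreamingAlgorithm

variable {Ω : Type*} [MeasurableSpace Ω] {d k : ℕ}

/-- The memory content after the first `t` points of the stream `x` have been read. -/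
def memory (A : StreamingAlgorithm Ω d k) (ω : Ω) (x : ℕ → EuclideanSpace ℝ (Fin d)) :
    ℕ → List Bool
  | 0 => A.init ω
  | t + 1 => A.update ω t (A.memory ω x t) (x t)

/-- The solution that is maintained after the first `t` points of the stream `x`. -/
def solution (A : StreamingAlgorithm Ω d k) (ω : Ω) (x : ℕ → EuclideanSpace ℝ (Fin d)) (t : ℕ) :
    Fin k → EuclideanSpace ℝ (Fin d) :=
  A.output ω t (A.memory ω x t)

/-- On every infinite stream `x` of points of `U`, with probability at least `1 - δ` the ratio
between the value of the maintained solution and the optimal value for the points read so far tends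
to `1`. Streams whose optimal value stays `0` forever are exempt, since the ratio makes no sense for
them; on all other streams the optimal value is positive from some time on. -/
def IsAsymptoticallyExact (A : StreamingAlgorithm Ω d k) (μ : Measure Ω)
    (V : (ℕ → EuclideanSpace ℝ (Fin d)) → ℕ → (Fin k → EuclideanSpace ℝ (Fin d)) → ℝ)
    (U : Set (EuclideanSpace ℝ (Fin d))) (δ : ℝ) : Prop :=
  ∀ x : ℕ → EuclideanSpace ℝ (Fin d), (∀ i, x i ∈ U) → (∃ n, 0 < optCost V x n) →
    1 - δ ≤ μ.real {ω | Tendsto (fun n => V x n (A.solution ω x n) / optCost V x n) atTop (𝓝 1)}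

/-- On every stream of `n` points of the grid `{1, …, n}^d`, almost surely the memory never holds
more than `s` bits. -/
def UsesSpaceAtMost (A : StreamingAlgorithm Ω d k) (μ : Measure Ω) (n s : ℕ) : Prop :=
  ∀ x : ℕ → EuclideanSpace ℝ (Fin d),
    (∀ i < n, ∀ j, ∃ m : ℕ, 1 ≤ m ∧ m ≤ n ∧ x i j = (m : ℝ)) →
      ∀ᵐ ω ∂μ, ∀ t ≤ n, (A.memory ω x t).length ≤ s

end StreamingAlgorithm

end

/-! Asymptotic exactness constrains the infinite future, so the stream may be continued
adversarially once the memory content is fixed. This embeds the INDEX problem: `N`, about `n / 8`,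
bits are written as points near `8, 16, …, 8N` on one axis, and for each `i` a continuation
independent of the bits makes the limiting solution disclose bit `i`.

The continuation is a finite query followed by `m = k - 1` pins repeated forever. Bounded cost
forces a center towards each pin (`eventually_exists_free_center`), so only one center stays free,
and a ratio tending to `1` makes it nearly optimal for the first `T` points
(`eventually_nearly_optimal_of_tendsto`). An `IndexGadget` makes its optimal position depend on bit
`i`. For `k`-median, the query balances all other points around point `i`, which becomes the median.
For `k`-means, two pins screen off the other points, and the free center sits at the mean of point
`i` and many query copies; the two pins are why `k ≥ 3` is required.

Equal memory contents lead to equal later solutions, so the memory is a random access code in which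
each bit succeeds with probability `1 - δ` (`StreamingAlgorithm.space_lower_bound`). Averaging fixes
the coins (`random_access_code_lower_bound`), and an exponential moment bound
(`code_length_lower_bound`) turns the advantage `1 - 2δ` into a linear lower bound. -/

/-! ### Random access codes with shared randomness. -/

/-- There are fewer than `2 ^ (s + 1)` bit strings of length at most `s`. -/
theorem exists_finset_bitStrings (s : ℕ) :
    ∃ F : Finset (List Bool), (∀ l : List Bool, l.length ≤ s → l ∈ F) ∧ F.card + 1 ≤ 2 ^ (s + 1) := by
  classical
  induction s with
  | zero =>
    refine ⟨{[]}, fun l hl => ?_, by simp⟩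
    simpa using hl
  | succ s ih =>
    obtain ⟨F, hF, hc⟩ := ih
    refine ⟨insert [] (F.image (List.cons true) ∪ F.image (List.cons false)), fun l hl => ?_, ?_⟩
    · rcases l with _ | ⟨b, l⟩
      · simp
      · have := hF l (by simpa using hl)
        cases b <;> simp [this]
    · have h1 := Finset.card_insert_le ([] : List Bool)
        (F.image (List.cons true) ∪ F.image (List.cons false))
      have h2 := Finset.card_union_le (F.image (List.cons true)) (F.image (List.cons false))
      have h3 := Finset.card_image_le (s := F) (f := List.cons true)
      have h4 := Finset.card_image_le (s := F) (f := List.cons false)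
      rw [pow_succ]
      omega

/-- `1` if the two bits agree, `-1` otherwise. -/
noncomputable def agreement (a b : Bool) : ℝ := if a = b then 1 else -1

/-- The sum over the cube factors over coordinates, and each factor is `exp r + exp (-r)` whatever
`y i` is: the moment generating function of `N` independent signs. -/
theorem sum_exp_agreement (N : ℕ) (y : Fin N → Bool) (r : ℝ) :
    ∑ b : Fin N → Bool, Real.exp (r * ∑ i, agreement (b i) (y i)) = (2 * Real.cosh r) ^ N := by
  have h1 : ∀ i, ∑ a : Bool, Real.exp (r * agreement a (y i)) = 2 * Real.cosh r := by
    intro i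
    rw [Real.cosh_eq]
    cases y i <;> simp [agreement] <;> ring
  have h2 := Finset.prod_univ_sum (fun _ : Fin N => (Finset.univ : Finset Bool))
    (fun i a => Real.exp (r * agreement a (y i)))
  simp only [h1, Finset.prod_const, Finset.card_univ, Fintype.card_fin,
    Fintype.piFinset_univ] at h2
  rw [h2]
  refine Finset.sum_congr rfl fun b _ => ?_
  rw [Finset.mul_sum, Real.exp_sum]

/-- A code of `N` bits into strings of length at most `s` whose bits are recovered with average
agreement `γ` needs about `γ ^ 2 * N / 2` nats. -/
theorem code_length_lower_bound {N s : ℕ} (mem : (Fin N → Bool) → List Bool)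
    (hmem : ∀ b, (mem b).length ≤ s) (dec : List Bool → Fin N → Bool) (γ : ℝ) (hγ : 0 ≤ γ)
    (h : γ * N * 2 ^ N ≤ ∑ b : Fin N → Bool, ∑ i, agreement (b i) (dec (mem b) i)) :
    γ ^ 2 * N / 2 ≤ (s + 1) * Real.log 2 := by
  obtain ⟨F, hF, hc⟩ := exists_finset_bitStrings s
  have hup : ∑ b : Fin N → Bool, Real.exp (γ * ∑ i, agreement (b i) (dec (mem b) i))
      ≤ 2 ^ (s + 1) * (2 * Real.exp (γ ^ 2 / 2)) ^ N := by
    -- Union bound: the actual code word is replaced by all possible ones, which makes the decoded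
    -- string independent of `b`.
    calc _ ≤ ∑ b : Fin N → Bool, ∑ σ ∈ F, Real.exp (γ * ∑ i, agreement (b i) (dec σ i)) :=
          Finset.sum_le_sum fun b _ => Finset.single_le_sum
            (f := fun σ => Real.exp (γ * ∑ i, agreement (b i) (dec σ i)))
            (fun σ _ => (Real.exp_pos _).le) (hF _ (hmem b))
      _ = F.card * (2 * Real.cosh γ) ^ N := by
          rw [Finset.sum_comm]
          simp [sum_exp_agreement]
      _ ≤ _ := by
          have : (F.card : ℝ) ≤ 2 ^ (s + 1) := by
            exact_mod_cast (Nat.le_succ _).trans hc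
          have h0 := (Real.cosh_pos γ).le
          gcongr
          exact Real.cosh_le_exp_half_sq γ
  have hlow : Real.exp (γ * (γ * N)) * 2 ^ N
      ≤ ∑ b : Fin N → Bool, Real.exp (γ * ∑ i, agreement (b i) (dec (mem b) i)) := by
    -- Jensen by hand: the tangent of `exp` at `a = γ * (γ * N)`; after summation the linear term is
    -- nonnegative by `h`.
    have ht : ∀ y a : ℝ, Real.exp a * (1 + (y - a)) ≤ Real.exp y := by
      intro y a
      have := Real.add_one_le_exp (y - a)
      calc _ ≤ Real.exp a * Real.exp (y - a) := by
            gcongr; linarith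
        _ = _ := by rw [← Real.exp_add]; congr 1; ring
    refine le_trans ?_ (Finset.sum_le_sum fun b _ => ht _ (γ * (γ * N)))
    rw [← Finset.mul_sum, Finset.sum_add_distrib, Finset.sum_sub_distrib, ← Finset.mul_sum]
    simp only [Finset.sum_const, Finset.card_univ, Fintype.card_fun, Fintype.card_bool,
      Fintype.card_fin, nsmul_eq_mul, mul_one, Nat.cast_pow, Nat.cast_ofNat]
    gcongr
    nlinarith [mul_le_mul_of_nonneg_left h hγ]
  have key := hlow.trans hup
  have key2 := Real.log_le_log (by positivity) key
  rw [Real.log_mul (by positivity) (by positivity), Real.log_mul (by positivity) (by positivity),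
    Real.log_exp, Real.log_pow, Real.log_pow, Real.log_pow, Real.log_mul (by norm_num)
    (by positivity), Real.log_exp] at key2
  push_cast at key2
  nlinarith

/-- Lower bound for randomized random access codes with shared randomness. -/
theorem random_access_code_lower_bound {Ω : Type*} [MeasurableSpace Ω] (μ : Measure Ω)
    [IsProbabilityMeasure μ] {N s : ℕ} (mem : Ω → (Fin N → Bool) → List Bool)
    (hmem : ∀ b, ∀ᵐ ω ∂μ, (mem ω b).length ≤ s) (E : (Fin N → Bool) → Fin N → Set Ω)
    (hE : ∀ b i, MeasurableSet (E b i)) (δ : ℝ) (hδ : δ < 1 / 2)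
    (hprob : ∀ b i, 1 - δ ≤ μ.real (E b i))
    (hsep : ∀ ω b b' i, mem ω b = mem ω b' → ω ∈ E b i → ω ∈ E b' i → b i = b' i) :
    (1 - 2 * δ) ^ 2 * N / 2 ≤ (s + 1) * Real.log 2 := by
  classical
  have hint : ∀ b i, Integrable ((E b i).indicator (fun _ => (1 : ℝ))) μ := fun b i =>
    (integrable_const 1).indicator (hE b i)
  let f : Ω → ℝ := fun ω => ∑ b : Fin N → Bool, ∑ i, (E b i).indicator (fun _ => (1 : ℝ)) ω
  have hf : Integrable f μ := integrable_finsetSum _ fun b _ => integrable_finsetSum _ fun i _ => hint b i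
  have hfi : (1 - δ) * N * 2 ^ N ≤ ∫ ω, f ω ∂μ := by
    have : ∫ ω, f ω ∂μ = ∑ b : Fin N → Bool, ∑ i, μ.real (E b i) := by
      simp only [f]
      rw [integral_finsetSum _ fun b _ => integrable_finsetSum _ fun i _ => hint b i]
      refine Finset.sum_congr rfl fun b _ => ?_
      rw [integral_finsetSum _ fun i _ => hint b i]
      refine Finset.sum_congr rfl fun i _ => ?_
      rw [integral_indicator_const _ (hE b i)]
      simp
    rw [this]
    calc (1 - δ) * N * 2 ^ N = ∑ b : Fin N → Bool, ∑ i : Fin N, (1 - δ) := by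
          simp; ring
      _ ≤ _ := Finset.sum_le_sum fun b _ => Finset.sum_le_sum fun i _ => hprob b i
  have hae : ∀ᵐ ω ∂μ, ∀ b, (mem ω b).length ≤ s := by
    rw [ae_all_iff]; exact hmem
  -- One outcome of the coins respects the space bound for all `b` and has at least the average
  -- number of good pairs `(b, i)`.
  obtain ⟨ω, hω, hle⟩ := exists_notMem_null_integral_le hf (ae_iff.1 hae)
  replace hω : ∀ b, (mem ω b).length ≤ s := by simpa using hω
  -- Any good `b` with memory `σ` may be consulted, since `hsep` makes all of them agree on bit `i`.
  let dec : List Bool → Fin N → Bool := fun σ i =>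
    decide (∃ b, mem ω b = σ ∧ ω ∈ E b i ∧ b i = true)
  have hdec : ∀ b i, ω ∈ E b i → b i = dec (mem ω b) i := by
    intro b i hb
    rcases hbi : b i with _ | _
    · symm
      simp only [dec, decide_eq_false_iff_not]
      rintro ⟨b', h1, h2, h3⟩
      have := hsep ω b b' i h1.symm hb h2
      rw [hbi, h3] at this
      cases this
    · symm
      simp only [dec, decide_eq_true_eq]
      exact ⟨b, rfl, hb, hbi⟩
  refine code_length_lower_bound (mem ω) hω dec _ (by linarith) ?_
  have hterm : ∀ b i, 2 * (E b i).indicator (fun _ => (1 : ℝ)) ω - 1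
      ≤ agreement (b i) (dec (mem ω b) i) := by
    intro b i
    by_cases hb : ω ∈ E b i
    · rw [← hdec b i hb]; simp [agreement, hb]; norm_num
    · unfold agreement; simp only [hb, not_false_eq_true, Set.indicator_of_notMem]; split_ifs <;> norm_num
  calc (1 - 2 * δ) * N * 2 ^ N ≤ 2 * f ω - N * 2 ^ N := by
        nlinarith [hfi.trans hle]
    _ = ∑ b : Fin N → Bool, ∑ i, (2 * (E b i).indicator (fun _ => (1 : ℝ)) ω - 1) := by
        simp only [Finset.sum_sub_distrib, ← Finset.mul_sum, f]
        simp; ring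
    _ ≤ _ := Finset.sum_le_sum fun b _ => Finset.sum_le_sum fun i _ => hterm b i

/-! ### Distances to center sets and their costs. -/

/-- The common form `∑ dist(x_i, C) ^ q` of the `k`-median and `k`-means objectives. -/
noncomputable def powCost (q d k : ℕ) (x : ℕ → EuclideanSpace ℝ (Fin d)) (n : ℕ)
    (C : Fin k → EuclideanSpace ℝ (Fin d)) : ℝ :=
  ∑ i ∈ Finset.range n, distToCenters (x i) C ^ q

theorem kMedianCost_eq_powCost (d k : ℕ) : kMedianCost d k = powCost 1 d k := by
  funext x n C
  simp [kMedianCost, powCost]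

theorem kMeansCost_eq_powCost (d k : ℕ) : kMeansCost d k = powCost 2 d k := rfl

section Distances

variable {d k m : ℕ}

theorem distToCenters_nonneg (p : EuclideanSpace ℝ (Fin d)) (C : Fin k → EuclideanSpace ℝ (Fin d)) :
    0 ≤ distToCenters p C :=
  Real.iInf_nonneg fun _ => dist_nonneg

theorem distToCenters_le (p : EuclideanSpace ℝ (Fin d)) (C : Fin k → EuclideanSpace ℝ (Fin d))
    (j : Fin k) : distToCenters p C ≤ dist p (C j) :=
  ciInf_le (Set.finite_range _).bddBelow j

theorem exists_distToCenters_eq (p : EuclideanSpace ℝ (Fin d))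
    (C : Fin (m + 1) → EuclideanSpace ℝ (Fin d)) : ∃ j, distToCenters p C = dist p (C j) := by
  obtain ⟨j, hj⟩ := exists_eq_ciInf_of_finite (f := fun j => dist p (C j))
  exact ⟨j, hj.symm⟩

theorem distToCenters_cons_cases (p c : EuclideanSpace ℝ (Fin d))
    (P : Fin m → EuclideanSpace ℝ (Fin d)) :
    distToCenters p (Fin.cons c P : Fin (m + 1) → _) = dist p c ∨
      ∃ l, distToCenters p (Fin.cons c P : Fin (m + 1) → _) = dist p (P l) := by
  obtain ⟨j, hj⟩ := exists_distToCenters_eq p (Fin.cons c P : Fin (m + 1) → _)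
  rw [hj]
  refine Fin.cases ?_ (fun l => ?_) j
  · simp
  · right; exact ⟨l, by simp⟩

theorem distToCenters_cons_le_left (p c : EuclideanSpace ℝ (Fin d))
    (P : Fin m → EuclideanSpace ℝ (Fin d)) :
    distToCenters p (Fin.cons c P : Fin (m + 1) → _) ≤ dist p c := by
  simpa using distToCenters_le p (Fin.cons c P : Fin (m + 1) → _) 0

theorem distToCenters_cons_le_right (p c : EuclideanSpace ℝ (Fin d))
    (P : Fin m → EuclideanSpace ℝ (Fin d)) (l : Fin m) :
    distToCenters p (Fin.cons c P : Fin (m + 1) → _) ≤ dist p (P l) := by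
  simpa using distToCenters_le p (Fin.cons c P : Fin (m + 1) → _) l.succ

theorem measurable_distToCenters (p : EuclideanSpace ℝ (Fin d)) :
    Measurable fun C : Fin k → EuclideanSpace ℝ (Fin d) => distToCenters p C := by
  unfold distToCenters
  exact Measurable.iInf fun j => measurable_const.dist (measurable_pi_apply j)

theorem measurable_powCost (q : ℕ) (x : ℕ → EuclideanSpace ℝ (Fin d)) (n : ℕ) :
    Measurable (powCost q d k x n) := by
  unfold powCost
  exact Finset.measurable_sum _ fun i _ => (measurable_distToCenters (x i)).pow_const q

theorem powCost_nonneg (q : ℕ) (x : ℕ → EuclideanSpace ℝ (Fin d)) (n : ℕ)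
    (C : Fin k → EuclideanSpace ℝ (Fin d)) : 0 ≤ powCost q d k x n C :=
  Finset.sum_nonneg fun _ _ => pow_nonneg (distToCenters_nonneg _ _) _

theorem optCost_powCost_le (q : ℕ) (x : ℕ → EuclideanSpace ℝ (Fin d)) (n : ℕ)
    (C : Fin k → EuclideanSpace ℝ (Fin d)) : optCost (powCost q d k) x n ≤ powCost q d k x n C :=
  ciInf_le ⟨0, by rintro _ ⟨C, rfl⟩; exact powCost_nonneg q x n C⟩ C

theorem powCost_mono (q : ℕ) (x : ℕ → EuclideanSpace ℝ (Fin d)) {n n' : ℕ} (h : n ≤ n')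
    (C : Fin k → EuclideanSpace ℝ (Fin d)) : powCost q d k x n C ≤ powCost q d k x n' C :=
  Finset.sum_le_sum_of_subset_of_nonneg (Finset.range_mono h)
    fun _ _ _ => pow_nonneg (distToCenters_nonneg _ _) _

end Distances

/-! ### Measurability and the dependence of a run on its past. -/

namespace StreamingAlgorithm

variable {Ω : Type*} [MeasurableSpace Ω] {d k : ℕ}

/-- There are only countably many bit strings, so splitting by the previous memory content gives a
countable union. -/
theorem measurableSet_memory_eq (A : StreamingAlgorithm Ω d k)
    (x : ℕ → EuclideanSpace ℝ (Fin d)) (t : ℕ) (τ : List Bool) :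
    MeasurableSet {ω | A.memory ω x t = τ} := by
  induction t generalizing τ with
  | zero => exact A.measurable_init τ
  | succ t ih =>
    have : {ω | A.memory ω x (t + 1) = τ}
        = ⋃ σ, ({ω | A.memory ω x t = σ} ∩ {ω | A.update ω t σ (x t) = τ}) := by
      ext ω; simp [memory]
    rw [this]
    exact MeasurableSet.iUnion fun σ => (ih σ).inter (A.measurable_update t σ (x t) τ)

theorem measurable_solution (A : StreamingAlgorithm Ω d k)
    (x : ℕ → EuclideanSpace ℝ (Fin d)) (t : ℕ) : Measurable fun ω => A.solution ω x t := by
  intro S hS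
  have : (fun ω => A.solution ω x t) ⁻¹' S
      = ⋃ σ, ({ω | A.memory ω x t = σ} ∩ (fun ω => A.output ω t σ) ⁻¹' S) := by
    ext ω; simp [solution]
  rw [this]
  exact MeasurableSet.iUnion fun σ =>
    (A.measurableSet_memory_eq x t σ).inter (A.measurable_output t σ hS)

theorem measurableSet_ratio_tendsto (A : StreamingAlgorithm Ω d k) (q : ℕ)
    (x : ℕ → EuclideanSpace ℝ (Fin d)) :
    MeasurableSet {ω | Tendsto (fun n => powCost q d k x n (A.solution ω x n) /
      optCost (powCost q d k) x n) atTop (𝓝 1)} :=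
  measurableSet_tendsto _ fun n =>
    ((measurable_powCost q x n).comp (A.measurable_solution x n)).div_const _

theorem memory_congr (A : StreamingAlgorithm Ω d k) (ω : Ω)
    {x y : ℕ → EuclideanSpace ℝ (Fin d)} {N : ℕ} (h : ∀ t < N, x t = y t) :
    A.memory ω x N = A.memory ω y N := by
  induction N with
  | zero => rfl
  | succ N ih =>
    simp only [memory]
    rw [ih fun t ht => h t (by omega), h N (by omega)]

theorem memory_congr_of_le (A : StreamingAlgorithm Ω d k) (ω : Ω)
    {x y : ℕ → EuclideanSpace ℝ (Fin d)} {N : ℕ} (hN : A.memory ω x N = A.memory ω y N)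
    (h : ∀ t, N ≤ t → x t = y t) {t : ℕ} (ht : N ≤ t) : A.memory ω x t = A.memory ω y t := by
  induction t, ht using Nat.le_induction with
  | base => exact hN
  | succ t ht ih => simp only [memory]; rw [ih, h t ht]

end StreamingAlgorithm

/-! ### Structure of nearly optimal center sets on streams with pins. -/

section NearOptimal

variable {d m : ℕ}

/-- Convexity of the power: `y + r` is a convex combination of `y` and `y + 1`. This gives an error
linear in `r` and uniform for `y ≤ Y`. -/
theorem add_pow_le_pow_add {y Y r : ℝ} (q : ℕ) (hy : 0 ≤ y) (hY : y ≤ Y) (hr : 0 ≤ r)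
    (hr1 : r ≤ 1) : (y + r) ^ q ≤ y ^ q + r * (Y + 1) ^ q := by
  have h := (convexOn_pow q).2 (show y ∈ Set.Ici 0 from hy)
    (show y + 1 ∈ Set.Ici 0 by simp; linarith) (show 0 ≤ 1 - r by linarith) hr (by ring)
  simp only [smul_eq_mul] at h
  have e : (1 - r) * y + r * (y + 1) = y + r := by ring
  rw [e] at h
  have h1 : (y + 1) ^ q ≤ (Y + 1) ^ q := by gcongr
  have h2 : 0 ≤ y ^ q := by positivity
  nlinarith [mul_le_mul_of_nonneg_left h1 hr]

/-- Points that are read infinitely often are approached by every sequence of center sets of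
bounded cost. -/
theorem eventually_distToCenters_lt {q : ℕ} {w : ℕ → EuclideanSpace ℝ (Fin d)}
    {p : EuclideanSpace ℝ (Fin d)} (hp : ∃ᶠ t in atTop, w t = p) (k : ℕ) (B : ℝ) {r : ℝ}
    (hr : 0 < r) :
    ∀ᶠ n in atTop, ∀ C : Fin k → EuclideanSpace ℝ (Fin d), powCost q d k w n C ≤ B →
      distToCenters p C < r := by
  classical
  -- With `a` copies of `p` read, a center set at distance at least `r` from `p` costs more than
  -- `B`.
  obtain ⟨a, ha⟩ := exists_nat_gt (B / r ^ q)
  obtain ⟨S, hS, hcard⟩ := (Nat.frequently_atTop_iff_infinite.1 hp).exists_subset_card_eq a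
  filter_upwards [eventually_ge_atTop (S.sup id + 1)] with n hn C hC
  by_contra! hcon
  have hsub : S ⊆ Finset.range n := fun t ht =>
    Finset.mem_range.2 (lt_of_lt_of_le (Nat.lt_succ_of_le (Finset.le_sup (f := id) ht)) hn)
  have h1 : (a : ℝ) * r ^ q ≤ powCost q d k w n C := by
    calc (a : ℝ) * r ^ q = ∑ t ∈ S, r ^ q := by simp [hcard]
      _ ≤ ∑ t ∈ S, distToCenters (w t) C ^ q := by
          refine Finset.sum_le_sum fun t ht => ?_
          rw [show w t = p from hS ht]
          gcongr
      _ ≤ _ := Finset.sum_le_sum_of_subset_of_nonneg hsub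
          fun _ _ _ => pow_nonneg (distToCenters_nonneg _ _) _
  rw [div_lt_iff₀ (by positivity)] at ha
  linarith

/-- If the points `P l` are read infinitely often, then late center sets of bounded cost consist of
one center near each `P l` and a single free center. -/
theorem eventually_exists_free_center {q : ℕ} (hq : q ≠ 0) {w : ℕ → EuclideanSpace ℝ (Fin d)}
    {T : ℕ} {P : Fin m → EuclideanSpace ℝ (Fin d)} (hP : Function.Injective P)
    (hinf : ∀ l, ∃ᶠ t in atTop, w t = P l) (B : ℝ) {ε : ℝ} (hε : 0 < ε) :
    ∀ᶠ n in atTop, ∀ C : Fin (m + 1) → EuclideanSpace ℝ (Fin d),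
      powCost q d (m + 1) w n C ≤ B → ∃ j₀,
        powCost q d (m + 1) w T (Fin.cons (C j₀) P) ≤ powCost q d (m + 1) w n C + ε ∧
        ∀ j ≠ j₀, ∃ l, dist (C j) (P l) < ε := by
  classical
  obtain ⟨ρ, hρ, hsep⟩ : ∃ ρ > 0, ∀ l l', l ≠ l' → ρ ≤ dist (P l) (P l') := by
    have hfin : (Set.range fun z : {z : Fin m × Fin m // z.1 ≠ z.2} =>
      dist (P z.1.1) (P z.1.2)).Finite := Set.finite_range _
    by_cases hne : Nonempty {z : Fin m × Fin m // z.1 ≠ z.2}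
    · obtain ⟨z, hz⟩ := exists_eq_ciInf_of_finite
        (f := fun z : {z : Fin m × Fin m // z.1 ≠ z.2} => dist (P z.1.1) (P z.1.2))
      refine ⟨dist (P z.1.1) (P z.1.2), dist_pos.2 fun h => z.2 (hP h), fun l l' hl => ?_⟩
      rw [hz]
      exact ciInf_le hfin.bddBelow ⟨(l, l'), hl⟩
    · exact ⟨1, one_pos, fun l l' hl => (hne ⟨⟨(l, l'), hl⟩⟩).elim⟩
  -- `Y` bounds each single distance `y`, as either `y ≤ 1` or `y ≤ y ^ q ≤ B`. `r * K` bounds the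
  -- total extra cost on the first `T` points when the centers near pins are moved onto them.
  set Y : ℝ := |B| + 1 with hY
  have hYpos : 0 < Y := by positivity
  set K : ℝ := T * (Y + 1) ^ q + 1 with hK
  have hKpos : 0 < K := by positivity
  obtain ⟨r, hr, hr1, hrε, hrρ, hrK⟩ : ∃ r : ℝ, 0 < r ∧ r ≤ 1 ∧ r ≤ ε ∧ 2 * r ≤ ρ ∧ r * K ≤ ε := by
    refine ⟨min (min 1 ε) (min (ρ / 2) (ε / K)), by positivity, ?_, ?_, ?_, ?_⟩
    · exact (min_le_left _ _).trans (min_le_left _ _)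
    · exact (min_le_left _ _).trans (min_le_right _ _)
    · have := (min_le_right (min 1 ε) (min (ρ / 2) (ε / K))).trans (min_le_left _ _)
      linarith
    · rw [← le_div_iff₀ hKpos]
      exact (min_le_right _ _).trans (min_le_right _ _)
  have hev := eventually_all.2 fun l =>
    eventually_distToCenters_lt (q := q) (hinf l) (m + 1) B hr
  filter_upwards [hev, eventually_ge_atTop T] with n hn hnT C hC
  have hnear : ∀ l, ∃ j, dist (P l) (C j) < r := fun l => by
    obtain ⟨j, hj⟩ := exists_distToCenters_eq (P l) C
    exact ⟨j, hj ▸ hn l C hC⟩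
  choose f hf using hnear
  -- Because `2 * r ≤ ρ`, no center serves two pins, so exactly one of the `m + 1` centers is left
  -- over.
  have hfinj : Function.Injective f := by
    intro l l' hl
    by_contra hne
    have h1 := hsep l l' hne
    have h2 := dist_triangle_right (P l) (P l') (C (f l))
    have h3 := hf l
    have h4 := hf l'
    rw [← hl] at h4
    linarith
  have hcardf : (Finset.univ.image f).card = m := by
    rw [Finset.card_image_of_injective _ hfinj]; simp
  have hcompl : (Finset.univ.image f)ᶜ.card = 1 := by
    rw [Finset.card_compl, hcardf]; simp
  obtain ⟨j₀, hj₀⟩ := Finset.card_eq_one.1 hcompl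
  have hothers : ∀ j ≠ j₀, ∃ l, f l = j := by
    intro j hj
    by_contra hcon
    have : j ∈ (Finset.univ.image f)ᶜ := by simpa using hcon
    rw [hj₀] at this
    exact hj (by simpa using this)
  refine ⟨j₀, ?_, fun j hj => ?_⟩
  · have hterm : ∀ t ∈ Finset.range T, distToCenters (w t) (Fin.cons (C j₀) P : Fin (m + 1) → _) ^ q
        ≤ distToCenters (w t) C ^ q + r * (Y + 1) ^ q := by
      intro t ht
      set y := distToCenters (w t) C with hy
      have hy0 : 0 ≤ y := distToCenters_nonneg _ _
      have hyB : y ^ q ≤ B := by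
        refine le_trans ?_ hC
        exact Finset.single_le_sum (f := fun t => distToCenters (w t) C ^ q)
          (fun _ _ => pow_nonneg (distToCenters_nonneg _ _) _)
          (Finset.mem_range.2 (lt_of_lt_of_le (Finset.mem_range.1 ht) hnT))
      have hyY : y ≤ Y := by
        rcases le_total y 1 with h | h
        · have := abs_nonneg B; linarith
        · have := le_self_pow₀ h hq
          have := le_abs_self B
          linarith
      refine le_trans ?_ (add_pow_le_pow_add q hy0 hyY hr.le hr1)
      refine pow_le_pow_left₀ (distToCenters_nonneg _ _) ?_ q
      obtain ⟨j, hj⟩ := exists_distToCenters_eq (w t) C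
      by_cases hjj : j = j₀
      · have := distToCenters_cons_le_left (w t) (C j₀) P
        rw [← hjj, ← hj] at this
        rw [← hjj]
        linarith
      · obtain ⟨l, rfl⟩ := hothers j hjj
        have h1 := distToCenters_cons_le_right (w t) (C j₀) P l
        have h2 := dist_triangle_right (w t) (P l) (C (f l))
        have h3 := hf l
        linarith
    have hsum := Finset.sum_le_sum hterm
    rw [Finset.sum_add_distrib] at hsum
    simp only [Finset.sum_const, Finset.card_range, nsmul_eq_mul] at hsum
    have hmono := powCost_mono q w hnT C
    have : (T : ℝ) * (r * (Y + 1) ^ q) ≤ ε := by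
      calc (T : ℝ) * (r * (Y + 1) ^ q) = r * (T * (Y + 1) ^ q) := by ring
        _ ≤ r * K := by gcongr; linarith
        _ ≤ ε := hrK
    unfold powCost at hmono ⊢
    linarith
  · obtain ⟨l, rfl⟩ := hothers j hj
    exact ⟨l, by rw [dist_comm]; exact (hf l).trans_le hrε⟩

theorem powCost_cons_eq {q : ℕ} (hq : q ≠ 0) {w : ℕ → EuclideanSpace ℝ (Fin d)} {T n : ℕ}
    {P : Fin m → EuclideanSpace ℝ (Fin d)} (htail : ∀ t, T ≤ t → ∃ l, w t = P l) (hn : T ≤ n)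
    (c : EuclideanSpace ℝ (Fin d)) :
    powCost q d (m + 1) w n (Fin.cons c P) = powCost q d (m + 1) w T (Fin.cons c P) := by
  symm
  refine Finset.sum_subset (Finset.range_mono hn) fun t _ ht => ?_
  obtain ⟨l, hl⟩ := htail t (by simpa using ht)
  have h1 := distToCenters_cons_le_right (w t) c P l
  rw [hl, dist_self] at h1
  rw [hl, le_antisymm h1 (distToCenters_nonneg _ _), zero_pow hq]

variable {q : ℕ} {w : ℕ → EuclideanSpace ℝ (Fin d)} {T : ℕ}
  {P : Fin m → EuclideanSpace ℝ (Fin d)} {c₀ : EuclideanSpace ℝ (Fin d)}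

/-- Write `F` for the minimal cost on the first `T` points. With tolerance `F / 2`, a late center
set either costs at least `F`, or its free center shows that it costs at least `F / 2`. -/
theorem eventually_optCost_pos (hq : q ≠ 0) (hP : Function.Injective P)
    (hinf : ∀ l, ∃ᶠ t in atTop, w t = P l)
    (hmin : ∀ c, powCost q d (m + 1) w T (Fin.cons c₀ P) ≤ powCost q d (m + 1) w T (Fin.cons c P))
    (hpos : 0 < powCost q d (m + 1) w T (Fin.cons c₀ P)) :
    ∀ᶠ n in atTop, 0 < optCost (powCost q d (m + 1)) w n := by
  filter_upwards [eventually_exists_free_center hq (T := T) hP hinf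
    (powCost q d (m + 1) w T (Fin.cons c₀ P)) (half_pos hpos)] with n hn
  refine lt_of_lt_of_le (half_pos hpos) (le_ciInf fun C => ?_)
  rcases le_total (powCost q d (m + 1) w n C) (powCost q d (m + 1) w T (Fin.cons c₀ P)) with h | h
  · obtain ⟨j₀, h1, -⟩ := hn C h
    have := hmin (C j₀)
    linarith
  · linarith

/-- Solutions whose value ratio tends to `1` finally consist of one center near each `P l` and a
free center that is nearly optimal for the first `T` points. -/
theorem eventually_nearly_optimal_of_tendsto (hq : q ≠ 0) (hP : Function.Injective P)
    (hinf : ∀ l, ∃ᶠ t in atTop, w t = P l) (htail : ∀ t, T ≤ t → ∃ l, w t = P l)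
    (hmin : ∀ c, powCost q d (m + 1) w T (Fin.cons c₀ P) ≤ powCost q d (m + 1) w T (Fin.cons c P))
    (hpos : 0 < powCost q d (m + 1) w T (Fin.cons c₀ P))
    {S : ℕ → Fin (m + 1) → EuclideanSpace ℝ (Fin d)}
    (hS : Tendsto (fun n => powCost q d (m + 1) w n (S n) / optCost (powCost q d (m + 1)) w n)
      atTop (𝓝 1)) {ε : ℝ} (hε : 0 < ε) :
    ∀ᶠ n in atTop, ∃ j₀, powCost q d (m + 1) w T (Fin.cons (S n j₀) P)
        ≤ powCost q d (m + 1) w T (Fin.cons c₀ P) + ε ∧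
      ∀ j ≠ j₀, ∃ l, dist (S n j) (P l) < ε := by
  set F := powCost q d (m + 1) w T (Fin.cons c₀ P) with hF
  -- The optimum is at most `F`, so this relative error costs at most `ε / 2`; moving centers onto
  -- the pins costs the other half.
  have hη : 0 < ε / (2 * F) := by positivity
  filter_upwards [eventually_optCost_pos hq hP hinf hmin hpos,
    hS.eventually (gt_mem_nhds (show (1 : ℝ) < 1 + ε / (2 * F) by linarith)),
    eventually_exists_free_center hq (T := T) hP hinf (F + ε / 2) (half_pos hε),
    eventually_ge_atTop T] with n h1 h2 h3 h4
  have hle : optCost (powCost q d (m + 1)) w n ≤ F := by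
    rw [hF, ← powCost_cons_eq hq htail h4 c₀]
    exact optCost_powCost_le q w n _
  have hcost : powCost q d (m + 1) w n (S n) ≤ F + ε / 2 := by
    rw [div_lt_iff₀ h1] at h2
    calc _ ≤ (1 + ε / (2 * F)) * optCost (powCost q d (m + 1)) w n := h2.le
      _ ≤ (1 + ε / (2 * F)) * F := by gcongr
      _ = F + ε / 2 := by field_simp
  obtain ⟨j₀, h5, h6⟩ := h3 _ hcost
  refine ⟨j₀, by linarith, fun j hj => ?_⟩
  obtain ⟨l, hl⟩ := h6 j hj
  exact ⟨l, by linarith⟩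

end NearOptimal

/-! ### Encoding streams and gadgets. -/

section Gadget

variable {d : ℕ}

/-- The point with coordinate `t` in direction `j₀` and all other coordinates `1`. -/
noncomputable def axisPoint (j₀ : Fin d) (t : ℝ) : EuclideanSpace ℝ (Fin d) :=
  WithLp.toLp 2 fun j => if j = j₀ then t else 1

@[simp]
theorem axisPoint_apply (j₀ : Fin d) (t : ℝ) (j : Fin d) :
    axisPoint j₀ t j = if j = j₀ then t else 1 := rfl

theorem dist_axisPoint (j₀ : Fin d) (s t : ℝ) : dist (axisPoint j₀ s) (axisPoint j₀ t) = |s - t| := by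
  rw [EuclideanSpace.dist_eq, Finset.sum_eq_single j₀]
  · simp [Real.dist_eq, Real.sqrt_sq_eq_abs]
  · intro j _ hj
    simp [hj]
  · simp

theorem abs_sub_apply_le_dist (p c : EuclideanSpace ℝ (Fin d)) (j : Fin d) :
    |p j - c j| ≤ dist p c := by
  have := PiLp.norm_apply_le (p - c) j
  rwa [← dist_eq_norm, PiLp.sub_apply, Real.norm_eq_abs] at this

/-- Centers may leave the axis; projecting onto it reduces the lower bounds on costs to dimension
one. -/
theorem abs_sub_le_dist_axisPoint (j₀ : Fin d) (t : ℝ) (c : EuclideanSpace ℝ (Fin d)) :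
    |t - c j₀| ≤ dist (axisPoint j₀ t) c := by
  simpa using abs_sub_apply_le_dist (axisPoint j₀ t) c j₀

/-- The positions of the points of a stream: first the encoding of the bits `b`, then up to time `T`
the query `bob`, then the `m` positions `pin` in cyclic order. -/
def indexPos {N : ℕ} (T m : ℕ) (bob pin : ℕ → ℤ) (b : Fin N → Bool) (t : ℕ) : ℤ :=
  if h : t < N then 8 * (t + 1) + (if b ⟨t, h⟩ then 1 else 0)
  else if t < T then bob t else pin (t % m)

theorem indexPos_of_lt {N T m : ℕ} {bob pin : ℕ → ℤ} {b : Fin N → Bool} (i : Fin N) :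
    indexPos T m bob pin b i = 8 * (i + 1) + (if b i then 1 else 0) := by
  simp [indexPos]

theorem indexPos_of_lt_bounds {N T m t : ℕ} {bob pin : ℕ → ℤ} {b : Fin N → Bool} (ht : t < N) :
    8 * ((t : ℤ) + 1) ≤ indexPos T m bob pin b t ∧
      indexPos T m bob pin b t ≤ 8 * ((t : ℤ) + 1) + 1 := by
  unfold indexPos
  rw [dif_pos ht]
  split_ifs <;> omega

theorem indexPos_query {N T m t : ℕ} {bob pin : ℕ → ℤ} {b : Fin N → Bool} (ht : N ≤ t)
    (hT : t < T) : indexPos T m bob pin b t = bob t := by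
  simp [indexPos, hT, not_lt.2 ht]

theorem indexPos_tail {N T m t : ℕ} {bob pin : ℕ → ℤ} {b : Fin N → Bool} (ht : N ≤ t)
    (hT : T ≤ t) : indexPos T m bob pin b t = pin (t % m) := by
  simp [indexPos, not_lt.2 hT, not_lt.2 ht]

/-- The stream of points at the positions `indexPos`. -/
noncomputable def indexStream (j₀ : Fin d) {N : ℕ} (T m : ℕ) (bob pin : ℕ → ℤ) (b : Fin N → Bool)
    (t : ℕ) : EuclideanSpace ℝ (Fin d) :=
  axisPoint j₀ (indexPos T m bob pin b t)

/-- The set of the points that are repeated forever. -/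
noncomputable def pinPoints (j₀ : Fin d) (m : ℕ) (pin : ℕ → ℤ) (l : Fin m) :
    EuclideanSpace ℝ (Fin d) :=
  axisPoint j₀ (pin l)

/-- A continuation of the encoding of `N` bits for which each nearly optimal free center reveals
the bit number `i`. -/
structure IndexGadget (q m N : ℕ) (j₀ : Fin d) (i : Fin N) where
  T : ℕ
  le_T : N ≤ T
  bob : ℕ → ℤ
  pin : ℕ → ℤ
  pin_injective : Function.Injective pin
  pin_far : ∀ l, 4 ≤ |pin l - 8 * ((i : ℤ) + 1)|
  θ : ℝ
  ε : ℝ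
  ε_pos : 0 < ε
  ε_le : ε ≤ 1
  exists_optimum : ∀ b : Fin N → Bool, ∃ c₀,
    0 < powCost q d (m + 1) (indexStream j₀ T m bob pin b) T (Fin.cons c₀ (pinPoints j₀ m pin)) ∧
    ∀ c, powCost q d (m + 1) (indexStream j₀ T m bob pin b) T (Fin.cons c (pinPoints j₀ m pin))
        ≤ powCost q d (m + 1) (indexStream j₀ T m bob pin b) T (Fin.cons c₀ (pinPoints j₀ m pin)) + ε →
      powCost q d (m + 1) (indexStream j₀ T m bob pin b) T (Fin.cons c₀ (pinPoints j₀ m pin))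
        ≤ powCost q d (m + 1) (indexStream j₀ T m bob pin b) T (Fin.cons c (pinPoints j₀ m pin)) ∧
      |c j₀ - 8 * ((i : ℝ) + 1)| < 2 ∧ (θ < c j₀ - 8 * ((i : ℝ) + 1) ↔ b i = true)

theorem powCost_indexStream_pos {q m N T : ℕ} {bob pin : ℕ → ℤ} {j₀ : Fin d} {b : Fin N → Bool}
    {x : ℝ} {t : ℕ} (ht : t < T) (hx : (indexPos T m bob pin b t : ℝ) ≠ x)
    (hpin : ∀ l, indexPos T m bob pin b t ≠ pin l) :
    0 < powCost q d (m + 1) (indexStream j₀ T m bob pin b) T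
      (Fin.cons (axisPoint j₀ x) (pinPoints j₀ m pin)) := by
  refine lt_of_lt_of_le ?_ (Finset.single_le_sum
    (f := fun t => distToCenters (indexStream j₀ T m bob pin b t)
      (Fin.cons (axisPoint j₀ x) (pinPoints j₀ m pin) : Fin (m + 1) → _) ^ q)
    (fun _ _ => pow_nonneg (distToCenters_nonneg _ _) _) (Finset.mem_range.2 ht))
  apply pow_pos
  rcases distToCenters_cons_cases (indexStream j₀ T m bob pin b t) (axisPoint j₀ x)
    (pinPoints j₀ m pin) with h | ⟨l, h⟩
  · rw [h, indexStream, dist_axisPoint]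
    exact abs_pos.2 (sub_ne_zero.2 hx)
  · rw [h, indexStream, pinPoints, dist_axisPoint]
    exact abs_pos.2 (sub_ne_zero.2 (by exact_mod_cast hpin l))

end Gadget

/-! ### From gadgets to a memory bound. -/

section LowerBound

variable {d : ℕ}

theorem frequently_indexStream_eq {N T m : ℕ} {bob pin : ℕ → ℤ} (j₀ : Fin d) (b : Fin N → Bool)
    (hT : N ≤ T) (l : Fin m) :
    ∃ᶠ t in atTop, indexStream j₀ T m bob pin b t = pinPoints j₀ m pin l := by
  rw [frequently_atTop]
  intro a
  have hm : 0 < m := l.pos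
  have h1 : a + T ≤ m * (a + T) := Nat.le_mul_of_pos_left _ hm
  refine ⟨m * (a + T) + l, by omega, ?_⟩
  rw [indexStream, indexPos_tail (by omega) (by omega), Nat.mul_add_mod, Nat.mod_eq_of_lt l.2]
  rfl

theorem pinPoints_injective {m : ℕ} {pin : ℕ → ℤ} (j₀ : Fin d) (h : Function.Injective pin) :
    Function.Injective (pinPoints j₀ m pin) := by
  intro l l' hl
  have := congrArg (fun p : EuclideanSpace ℝ (Fin d) => p j₀) hl
  simp only [pinPoints, axisPoint_apply, if_true] at this
  exact Fin.ext (h (by exact_mod_cast this))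

theorem indexStream_mem_integerPoints {N T m : ℕ} {bob pin : ℕ → ℤ} (j₀ : Fin d)
    (b : Fin N → Bool) (t : ℕ) : indexStream j₀ T m bob pin b t ∈ integerPoints d := by
  intro j
  by_cases hj : j = j₀
  · exact ⟨indexPos T m bob pin b t, by simp [indexStream, hj]⟩
  · exact ⟨1, by simp [indexStream, hj]⟩

namespace IndexGadget

variable {q m N : ℕ} {j₀ : Fin d} {i : Fin N}

/-- The stream that belongs to a gadget. -/
noncomputable def stream (G : IndexGadget q m N j₀ i) (b : Fin N → Bool) :
    ℕ → EuclideanSpace ℝ (Fin d) :=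
  indexStream j₀ G.T m G.bob G.pin b

theorem stream_congr (G : IndexGadget q m N j₀ i) (b b' : Fin N → Bool) {t : ℕ} (ht : N ≤ t) :
    G.stream b t = G.stream b' t := by
  simp [stream, indexStream, indexPos, not_lt.2 ht]

theorem exists_eq_pinPoints (G : IndexGadget q m N j₀ i) (hm : 0 < m) (b : Fin N → Bool) (t : ℕ)
    (ht : G.T ≤ t) : ∃ l, G.stream b t = pinPoints j₀ m G.pin l :=
  ⟨⟨t % m, Nat.mod_lt _ hm⟩, by
    rw [stream, indexStream, indexPos_tail (G.le_T.trans ht) ht]; rfl⟩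

/-- The gadget asserts minimality only against centers within `ε` of `c₀`'s cost, but any cheaper
center is among these. -/
theorem exists_minimizer (G : IndexGadget q m N j₀ i) (b : Fin N → Bool) : ∃ c₀,
    0 < powCost q d (m + 1) (G.stream b) G.T (Fin.cons c₀ (pinPoints j₀ m G.pin)) ∧
    (∀ c, powCost q d (m + 1) (G.stream b) G.T (Fin.cons c₀ (pinPoints j₀ m G.pin))
      ≤ powCost q d (m + 1) (G.stream b) G.T (Fin.cons c (pinPoints j₀ m G.pin))) ∧
    ∀ c, powCost q d (m + 1) (G.stream b) G.T (Fin.cons c (pinPoints j₀ m G.pin))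
        ≤ powCost q d (m + 1) (G.stream b) G.T (Fin.cons c₀ (pinPoints j₀ m G.pin)) + G.ε →
      |c j₀ - 8 * ((i : ℝ) + 1)| < 2 ∧ (G.θ < c j₀ - 8 * ((i : ℝ) + 1) ↔ b i = true) := by
  obtain ⟨c₀, h1, h2⟩ := G.exists_optimum b
  refine ⟨c₀, h1, fun c => ?_, fun c hc => (h2 c hc).2⟩
  rcases le_total (powCost q d (m + 1) (G.stream b) G.T (Fin.cons c (pinPoints j₀ m G.pin)))
    (powCost q d (m + 1) (G.stream b) G.T (Fin.cons c₀ (pinPoints j₀ m G.pin))) with h | h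
  · exact (h2 c (h.trans (le_add_of_nonneg_right G.ε_pos.le))).1
  · exact h

theorem exists_optCost_pos (G : IndexGadget q m N j₀ i) (hq : q ≠ 0) (b : Fin N → Bool) :
    ∃ n, 0 < optCost (powCost q d (m + 1)) (G.stream b) n := by
  obtain ⟨c₀, h1, h2, -⟩ := G.exists_minimizer b
  exact (eventually_optCost_pos hq (pinPoints_injective j₀ G.pin_injective)
    (frequently_indexStream_eq j₀ b G.le_T) h2 h1).exists

/-- Asymptotically optimal solutions reveal the bit number `i`. -/
theorem eventually_reveals (G : IndexGadget q m N j₀ i) (hq : q ≠ 0) (hm : 0 < m)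
    (b : Fin N → Bool) {S : ℕ → Fin (m + 1) → EuclideanSpace ℝ (Fin d)}
    (hS : Tendsto (fun n => powCost q d (m + 1) (G.stream b) n (S n) /
      optCost (powCost q d (m + 1)) (G.stream b) n) atTop (𝓝 1)) :
    ∀ᶠ n in atTop, (∃ j, |S n j j₀ - 8 * ((i : ℝ) + 1)| < 2 ∧
      G.θ < S n j j₀ - 8 * ((i : ℝ) + 1)) ↔ b i = true := by
  obtain ⟨c₀, h1, h2, h3⟩ := G.exists_minimizer b
  filter_upwards [eventually_nearly_optimal_of_tendsto hq
    (pinPoints_injective j₀ G.pin_injective) (frequently_indexStream_eq j₀ b G.le_T)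
    (G.exists_eq_pinPoints hm b) h2 h1 hS G.ε_pos] with n hn
  obtain ⟨j₁, h4, h5⟩ := hn
  obtain ⟨h6, h7⟩ := h3 _ h4
  constructor
  · rintro ⟨j, h8, h9⟩
    by_cases hj : j = j₁
    · rw [← h7, ← hj]; exact h9
    -- A center within `ε ≤ 1` of a pin is at distance at least `3` from `8 * (i + 1)`, hence fails
    -- the test.
    · exfalso
      obtain ⟨l, hl⟩ := h5 j hj
      have h10 := abs_sub_apply_le_dist (S n j) (pinPoints j₀ m G.pin l) j₀
      simp only [pinPoints, axisPoint_apply, if_true] at h10 hl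
      have h11 : (4 : ℝ) ≤ |(G.pin l : ℝ) - 8 * ((i : ℝ) + 1)| := by exact_mod_cast G.pin_far l
      have h12 := abs_sub_le ((G.pin l : ℝ)) (S n j j₀) (8 * ((i : ℝ) + 1))
      rw [abs_sub_comm (G.pin l : ℝ) (S n j j₀)] at h12
      have := G.ε_le
      linarith
  · intro hb
    exact ⟨j₁, h6, h7.2 hb⟩

end IndexGadget

/-- Gadgets for all bits turn a streaming algorithm into a random access code. -/
theorem StreamingAlgorithm.space_lower_bound {q m N n s : ℕ} {j₀ : Fin d} (hq : q ≠ 0) (hm : 0 < m)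
    (G : ∀ i : Fin N, IndexGadget q m N j₀ i) {Ω : Type*} [MeasurableSpace Ω] {μ : Measure Ω}
    [IsProbabilityMeasure μ] (A : StreamingAlgorithm Ω d (m + 1)) {δ : ℝ} (hδ : δ < 1 / 2)
    {U : Set (EuclideanSpace ℝ (Fin d))} (hU : integerPoints d ⊆ U)
    (hA : A.IsAsymptoticallyExact μ (powCost q d (m + 1)) U δ) (hn : 8 * N + 1 ≤ n)
    (hs : A.UsesSpaceAtMost μ n s) : (1 - 2 * δ) ^ 2 * N / 2 ≤ (s + 1) * Real.log 2 := by
  -- The encoding padded by the grid position `1`. The space bound is applied only to this stream,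
  -- so gadget continuations may leave the grid.
  let x : (Fin N → Bool) → ℕ → EuclideanSpace ℝ (Fin d) := fun b =>
    indexStream j₀ N 1 (fun _ => 1) (fun _ => 1) b
  have hx : ∀ b i, ∀ t < N, (G i).stream b t = x b t := by
    intro b i t ht
    simp [x, IndexGadget.stream, indexStream, indexPos, ht]
  refine random_access_code_lower_bound μ (fun ω b => A.memory ω (x b) N) (fun b => ?_)
    (fun b i => {ω | Tendsto (fun n => powCost q d (m + 1) ((G i).stream b) n
      (A.solution ω ((G i).stream b) n) / optCost (powCost q d (m + 1)) ((G i).stream b) n)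
      atTop (𝓝 1)})
    (fun b i => A.measurableSet_ratio_tendsto q _) δ hδ
    (fun b i => hA _ (fun t => hU (indexStream_mem_integerPoints j₀ b t))
      ((G i).exists_optCost_pos hq b)) ?_
  · refine (hs (x b) fun t _ j => ?_).mono fun ω hω => hω N (by omega)
    by_cases hj : j = j₀
    · by_cases htN : t < N
      · obtain ⟨h1, h2⟩ := indexPos_of_lt_bounds (T := N) (m := 1) (bob := fun _ => 1)
          (pin := fun _ => 1) (b := b) htN
        refine ⟨(indexPos N 1 (fun _ => 1) (fun _ => 1) b t).toNat, by omega, by omega, ?_⟩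
        simp only [x, indexStream, axisPoint_apply, hj, if_true]
        have : ((indexPos N 1 (fun _ => 1) (fun _ => 1) b t).toNat : ℤ)
          = indexPos N 1 (fun _ => 1) (fun _ => 1) b t := Int.toNat_of_nonneg (by omega)
        exact_mod_cast this.symm
      · exact ⟨1, le_rfl, by omega, by simp [x, indexStream, indexPos, hj, htN]⟩
    · exact ⟨1, le_rfl, by omega, by simp [x, indexStream, hj]⟩
  · intro ω b b' i hmem h1 h2
    have hmem' : A.memory ω ((G i).stream b) N = A.memory ω ((G i).stream b') N := by
      rw [A.memory_congr ω (hx b i), A.memory_congr ω (hx b' i)]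
      exact hmem
    obtain ⟨t, ⟨h3, h4⟩, ht⟩ := ((((G i).eventually_reveals hq hm b h1).and
      ((G i).eventually_reveals hq hm b' h2)).and (eventually_ge_atTop N)).exists
    have hsol : A.solution ω ((G i).stream b) t = A.solution ω ((G i).stream b') t := by
      unfold StreamingAlgorithm.solution
      rw [A.memory_congr_of_le ω hmem' (fun r hr => (G i).stream_congr b b' hr) ht]
    rw [hsol] at h3
    exact Bool.eq_iff_iff.2 (h3.symm.trans h4)

end LowerBound

/-! ### Construction of the two gadgets. -/

section Gadgets

variable {d : ℕ}

theorem exists_fin_ne {N : ℕ} (hN : 2 ≤ N) (i : Fin N) : ∃ l : Fin N, l ≠ i := by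
  have : Nontrivial (Fin N) := Fin.nontrivial_iff_two_le.2 hN
  exact exists_ne i

theorem indexPos_ne {N T m : ℕ} {bob pin : ℕ → ℤ} {b : Fin N → Bool} {l i : Fin N} (h : l ≠ i) :
    indexPos T m bob pin b l ≠ indexPos T m bob pin b i := by
  have h1 := indexPos_of_lt_bounds (T := T) (m := m) (bob := bob) (pin := pin) (b := b) l.2
  have h2 := indexPos_of_lt_bounds (T := T) (m := m) (bob := bob) (pin := pin) (b := b) i.2
  have h3 : (l : ℕ) ≠ i := fun h' => h (Fin.ext h')
  omega

theorem abs_sub_add_abs_sub_le_of_between {p r x u : ℝ} (h : p ≤ x ∧ x ≤ r ∨ r ≤ x ∧ x ≤ p) :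
    |p - x| + |r - x| ≤ |p - u| + |r - u| := by
  rcases h with ⟨h1, h2⟩ | ⟨h1, h2⟩
  · rw [abs_of_nonpos (by linarith : p - x ≤ 0), abs_of_nonneg (by linarith : 0 ≤ r - x)]
    have := neg_abs_le (p - u)
    have := le_abs_self (r - u)
    linarith
  · rw [abs_of_nonneg (by linarith : 0 ≤ p - x), abs_of_nonpos (by linarith : r - x ≤ 0)]
    have := neg_abs_le (r - u)
    have := le_abs_self (p - u)
    linarith

/-- The query for `k`-median: it balances the points on both sides of the point number `i`, which
becomes the median. -/
def medianQuery (N i : ℕ) (t : ℕ) : ℤ :=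
  if t < N + i then 8 * N + 8 else if N + i < t then 0 else -(2 * N * (8 * N + 10) + 2)

/-- Positions far away from all points of the encoding. -/
def medianPin (N : ℕ) (l : ℕ) : ℤ := -((2 * N * (8 * N + 10) + 2) * (l + 1))

/-- Each point `l ≠ i` is paired with a query point on the other side of point `i`, so a pair's cost
is least for centers between its members. What remains is the distance to point `i`, and an error of
`1/4` separates the positions of its two bit values. The unpaired query slot `N + i` holds pin `0`
and costs nothing. -/
theorem nonempty_medianGadget {m N : ℕ} (hm : 0 < m) (hN : 2 ≤ N) (j₀ : Fin d) (i : Fin N) :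
    Nonempty (IndexGadget 1 m N j₀ i) := by
  have hi := i.2
  have hNN : (0 : ℤ) ≤ 2 * N * (8 * N + 10) := by positivity
  have hpinle : ∀ l, medianPin N l ≤ -(2 * N * (8 * N + 10) + 2) := by
    intro l
    unfold medianPin
    have : (0 : ℤ) ≤ l := by positivity
    nlinarith
  refine ⟨⟨N + N, by omega, medianQuery N i, medianPin N, ?_, ?_, 1 / 2, 1 / 4, by norm_num,
    by norm_num, fun b => ?_⟩⟩
  · intro l l' h
    have h0 : (2 * N * (8 * N + 10) + 2 : ℤ) ≠ 0 := by omega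
    have := mul_left_cancel₀ h0 (neg_injective h)
    omega
  · intro l
    have := hpinle l
    rw [abs_of_nonpos (by omega)]
    omega
  set pos := indexPos (N + N) m (medianQuery N i) (medianPin N) b with hpos
  set P := pinPoints j₀ m (medianPin N) with hP
  set x : ℝ := ((pos (i : ℕ) : ℤ) : ℝ) with hx
  have hxi := indexPos_of_lt_bounds (T := N + N) (m := m) (bob := medianQuery N i)
    (pin := medianPin N) (b := b) hi
  rw [← hpos] at hxi
  have hquery : ∀ l < N, pos (N + l) = medianQuery N i (N + l) := fun l hl =>
    indexPos_query (by omega) (by omega)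
  have hrange : ∀ t < N + N, t ≠ N + i → 0 ≤ pos t ∧ pos t ≤ 8 * N + 8 := by
    intro t ht hti
    by_cases htN : t < N
    · have := indexPos_of_lt_bounds (T := N + N) (m := m) (bob := medianQuery N i)
        (pin := medianPin N) (b := b) htN
      rw [← hpos] at this
      omega
    · have := hquery (t - N) (by omega)
      rw [Nat.add_sub_cancel' (by omega)] at this
      rw [this, medianQuery]
      split_ifs <;> omega
  let g : EuclideanSpace ℝ (Fin d) → ℕ → ℝ := fun c t =>
    distToCenters (indexStream j₀ (N + N) m (medianQuery N i) (medianPin N) b t)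
      (Fin.cons c P : Fin (m + 1) → _)
  have hcost : ∀ c, powCost 1 d (m + 1) (indexStream j₀ (N + N) m (medianQuery N i) (medianPin N) b)
      (N + N) (Fin.cons c P) = ∑ t ∈ Finset.range (N + N), g c t := by
    intro c; simp [powCost, g]
  have hg0 : ∀ c t, 0 ≤ g c t := fun c t => distToCenters_nonneg _ _
  have hgpin : ∀ c, g c (N + i) = 0 := by
    intro c
    refine le_antisymm ?_ (hg0 _ _)
    refine (distToCenters_cons_le_right _ c P ⟨0, hm⟩).trans ?_
    rw [hP, pinPoints, indexStream, dist_axisPoint, ← hpos, hquery i hi]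
    simp [medianQuery, medianPin]
  have hgx : ∀ t, g (axisPoint j₀ x) t ≤ |(pos t : ℝ) - x| := by
    intro t
    refine (distToCenters_cons_le_left _ _ P).trans ?_
    rw [indexStream, dist_axisPoint]
  have hFx : ∑ t ∈ Finset.range (N + N), g (axisPoint j₀ x) t ≤ 2 * N * (8 * N + 10) := by
    have : ∀ t ∈ Finset.range (N + N), g (axisPoint j₀ x) t ≤ 8 * N + 10 := by
      intro t ht
      by_cases hti : t = N + i
      · rw [hti, hgpin]; positivity
      · refine (hgx t).trans ?_
        have h1 := hrange t (Finset.mem_range.1 ht) hti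
        have h2 : |pos t - pos i| ≤ 8 * N + 10 := by
          rw [abs_le]; constructor <;> omega
        rw [hx]
        exact_mod_cast h2
    refine (Finset.sum_le_card_nsmul _ _ _ this).trans (le_of_eq ?_)
    simp; ring
  refine ⟨axisPoint j₀ x, ?_, fun c hc => ?_⟩
  · obtain ⟨l, hl⟩ := exists_fin_ne hN i
    refine powCost_indexStream_pos (t := l) (by omega) ?_ fun l' => ?_
    · rw [hx]
      exact_mod_cast indexPos_ne hl
    · have h1 := hpinle l'
      have h2 := hrange l (by omega) (by omega)
      rw [← hpos]
      omega
  · simp only [hcost] at hc ⊢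
    -- Serving such a point by a pin would alone cost at least `2 * N * (8 * N + 10) + 2`, beyond
    -- the bound `hFx` plus `ε`.
    have hgc : ∀ t < N + N, t ≠ N + i → |(pos t : ℝ) - c j₀| ≤ g c t := by
      intro t ht hti
      rcases distToCenters_cons_cases (indexStream j₀ (N + N) m (medianQuery N i) (medianPin N) b t)
        c P with h | ⟨l, h⟩
      · simp only [g]
        rw [h]
        exact abs_sub_le_dist_axisPoint j₀ _ c
      · exfalso
        replace h : g c t = |(pos t : ℝ) - medianPin N l| :=
          h.trans (by rw [hP, pinPoints, indexStream, dist_axisPoint])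
        have h1 : g c t ≤ ∑ t ∈ Finset.range (N + N), g c t :=
          Finset.single_le_sum (fun t _ => hg0 c t) (Finset.mem_range.2 ht)
        have h2 : (2 * N * (8 * N + 10) + 2 : ℤ) ≤ |pos t - medianPin N l| := by
          have h3 := hrange t ht hti
          have h4 := hpinle l
          exact le_trans (by omega) (le_abs_self _)
        have h5 : (2 * N * (8 * N + 10) + 2 : ℝ) ≤ g c t := by
          rw [h]
          exact_mod_cast h2
        linarith
    have hpair : ∀ l ∈ Finset.range N, g (axisPoint j₀ x) l + g (axisPoint j₀ x) (N + l)
        + (if l = i then |x - c j₀| else 0) ≤ g c l + g c (N + l) := by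
      intro l hl
      have hlN := Finset.mem_range.1 hl
      by_cases hli : l = i
      · have h1 := hgx l
        have h2 := hgc l (by omega) (by omega)
        rw [hli] at h1 h2 ⊢
        rw [← hx] at h1 h2
        rw [sub_self, abs_zero] at h1
        rw [hgpin, hgpin, if_pos rfl]
        linarith
      · rw [if_neg hli, add_zero]
        refine (add_le_add (hgx l) (hgx (N + l))).trans
          (le_trans ?_ (add_le_add (hgc l (by omega) (by omega))
            (hgc (N + l) (by omega) (by omega))))
        apply abs_sub_add_abs_sub_le_of_between
        have h1 := indexPos_of_lt_bounds (T := N + N) (m := m) (bob := medianQuery N i)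
          (pin := medianPin N) (b := b) hlN
        rw [← hpos] at h1
        rcases lt_or_gt_of_ne hli with h | h
        · have h2 : pos (N + l) = 8 * N + 8 := by
            rw [hquery l hlN, medianQuery, if_pos (by omega)]
          left
          rw [hx]
          constructor
          · exact_mod_cast (show pos l ≤ pos i by omega)
          · exact_mod_cast (show pos i ≤ pos (N + l) by omega)
        · have h2 : pos (N + l) = 0 := by
            rw [hquery l hlN, medianQuery, if_neg (by omega), if_pos (by omega)]
          right
          rw [hx]
          constructor
          · exact_mod_cast (show pos (N + l) ≤ pos i by omega)
          · exact_mod_cast (show pos i ≤ pos l by omega)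
    have hsum := Finset.sum_le_sum hpair
    rw [Finset.sum_add_distrib, Finset.sum_add_distrib, Finset.sum_add_distrib,
      Finset.sum_ite_eq' (Finset.range N) (i : ℕ), if_pos (Finset.mem_range.2 hi),
      ← Finset.sum_range_add, ← Finset.sum_range_add] at hsum
    have hxu : |x - c j₀| ≤ 1 / 4 := by linarith
    have habs := abs_nonneg (x - c j₀)
    refine ⟨by linarith, ?_⟩
    rw [abs_le] at hxu
    have hxb : x = 8 * ((i : ℝ) + 1) + (if b i then 1 else 0) := by
      rw [hx, hpos, indexPos_of_lt]
      push_cast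
      rfl
    rw [hxb] at hxu
    obtain ⟨h1, h2⟩ := hxu
    rw [abs_lt]
    cases hb : b i
    · simp only [hb, Bool.false_eq_true, if_false] at h1 h2
      refine ⟨⟨by linarith, by linarith⟩, ?_⟩
      simp
      linarith
    · simp only [hb, if_true] at h1 h2
      refine ⟨⟨by linarith, by linarith⟩, ?_⟩
      simp only [iff_true]
      linarith

/-- The number of copies of the query point for `k`-means. -/
def meansMultiplicity (N : ℕ) : ℕ := N * (8 * N + 10) ^ 2 + 2

/-- Positions `8` apart, in the middle of which lies the point number `i`. -/
def meansPin (i : ℕ) (l : ℕ) : ℤ := 8 * (i + 1) - 4 + 8 * l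

-- The `M` query copies at `z = 8 * (i + 1)` hold the free center within distance `1` of `z`, where
-- the pins `z - 4` and `z + 4` are nearer to all other encoding points. Only point `i` and the
-- copies then matter, and their mean is `z + β / (M + 1)` for the bit `β`. The threshold `θ` is
-- halfway between the two cases.
set_option maxHeartbeats 1000000 in
theorem nonempty_meansGadget {m N : ℕ} (hm : 2 ≤ m) (hN : 2 ≤ N) (j₀ : Fin d) (i : Fin N) :
    Nonempty (IndexGadget 2 m N j₀ i) := by
  have hi := i.2
  set M := meansMultiplicity N with hM
  have hM0 : (0 : ℝ) < M + 1 := by positivity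
  refine ⟨⟨N + M, by omega, fun _ => 8 * (i + 1), meansPin i, ?_, ?_, 1 / (2 * (M + 1)),
    1 / (16 * (M + 1)), by positivity, ?_, fun b => ?_⟩⟩
  · intro l l' h
    unfold meansPin at h
    omega
  · intro l
    unfold meansPin
    rcases Nat.eq_zero_or_pos l with rfl | hl
    · simp
    · exact le_trans (by omega) (le_abs_self _)
  · rw [div_le_one (by positivity)]
    linarith [show (0 : ℝ) ≤ M by positivity]
  set pos := indexPos (N + M) m (fun _ => 8 * ((i : ℤ) + 1)) (meansPin i) b with hpos
  set P := pinPoints j₀ m (meansPin i) with hP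
  set z : ℝ := 8 * ((i : ℝ) + 1) with hz
  set β : ℝ := if b i then 1 else 0 with hβ
  have hβ01 : β = 0 ∨ β = 1 := by rw [hβ]; split_ifs <;> simp
  set v : ℝ := β / (M + 1) with hv
  have hvM : v * (M + 1) = β := div_mul_cancel₀ _ hM0.ne'
  have hv0 : 0 ≤ v := by rcases hβ01 with h | h <;> rw [hv, h] <;> positivity
  have hposi : (pos i : ℝ) = z + β := by
    rw [hpos, indexPos_of_lt]
    push_cast
    rfl
  have hposq : ∀ t < M, (pos (N + t) : ℝ) = z := by
    intro t ht
    rw [hpos, indexPos_query (by omega) (by omega)]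
    push_cast
    rfl
  let g : EuclideanSpace ℝ (Fin d) → ℕ → ℝ := fun c t =>
    distToCenters (indexStream j₀ (N + M) m (fun _ => 8 * ((i : ℤ) + 1)) (meansPin i) b t)
      (Fin.cons c P : Fin (m + 1) → _)
  have hcost : ∀ c, powCost 2 d (m + 1)
      (indexStream j₀ (N + M) m (fun _ => 8 * ((i : ℤ) + 1)) (meansPin i) b)
      (N + M) (Fin.cons c P) = ∑ t ∈ Finset.range N, g c t ^ 2
        + ∑ t ∈ Finset.range M, g c (N + t) ^ 2 := by
    intro c
    rw [← Finset.sum_range_add (fun t => g c t ^ 2)]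
    rfl
  have hg0 : ∀ c t, 0 ≤ g c t := fun c t => distToCenters_nonneg _ _
  have hgpin : ∀ c t (l : Fin m), g c t ≤ |(pos t : ℝ) - meansPin i l| := by
    intro c t l
    refine (distToCenters_cons_le_right _ c P l).trans ?_
    rw [hP, pinPoints, indexStream, dist_axisPoint]
  have hgaxis : ∀ u t, g (axisPoint j₀ u) t ≤ |(pos t : ℝ) - u| := by
    intro u t
    refine (distToCenters_cons_le_left _ _ P).trans ?_
    rw [indexStream, dist_axisPoint]
  have hgcases : ∀ c t, |(pos t : ℝ) - c j₀| ≤ dist (axisPoint j₀ (pos t : ℝ)) c ∧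
      (g c t = dist (axisPoint j₀ (pos t : ℝ)) c ∨
      ∃ l : Fin m, g c t = |(pos t : ℝ) - meansPin i l|) := by
    intro c t
    refine ⟨abs_sub_le_dist_axisPoint j₀ _ c, ?_⟩
    rcases distToCenters_cons_cases
      (indexStream j₀ (N + M) m (fun _ => 8 * ((i : ℤ) + 1)) (meansPin i) b t) c P with h | ⟨l, h⟩
    · exact Or.inl h
    · rw [hP, pinPoints, indexStream, dist_axisPoint] at h
      exact Or.inr ⟨l, h⟩
  have hpinfar : ∀ l, 4 ≤ |z - meansPin i l| ∧ 3 ≤ |z + 1 - meansPin i l| := by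
    intro l
    have h1 : 4 ≤ |8 * ((i : ℤ) + 1) - meansPin i l| ∧
        3 ≤ |8 * ((i : ℤ) + 1) + 1 - meansPin i l| := by
      unfold meansPin
      rcases Nat.eq_zero_or_pos l with rfl | hl
      · constructor
        · exact le_trans (by omega) (le_abs_self _)
        · exact le_trans (by omega) (le_abs_self _)
      · constructor
        · exact le_trans (by omega) (neg_le_abs _)
        · exact le_trans (by omega) (neg_le_abs _)
    rw [hz]
    exact_mod_cast h1
  set c₀ := axisPoint j₀ (z + v) with hc₀
  have hFc₀ : ∑ t ∈ Finset.range N, g c₀ t ^ 2 + ∑ t ∈ Finset.range M, g c₀ (N + t) ^ 2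
      ≤ M - 1 := by
    have h1 : ∀ t ∈ Finset.range N, g c₀ t ^ 2 ≤ (8 * N + 10 : ℝ) ^ 2 := by
      intro t ht
      refine pow_le_pow_left₀ (hg0 _ _) ((hgpin c₀ t ⟨0, by omega⟩).trans ?_) 2
      have h2 := indexPos_of_lt_bounds (T := N + M) (m := m) (bob := fun _ => 8 * ((i : ℤ) + 1))
        (pin := meansPin i) (b := b) (Finset.mem_range.1 ht)
      have h3 := Finset.mem_range.1 ht
      rw [← hpos] at h2
      have h4 : |pos t - meansPin i 0| ≤ 8 * N + 10 := by
        unfold meansPin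
        rw [abs_le]; constructor <;> omega
      exact_mod_cast h4
    have h2 : ∀ t ∈ Finset.range M, g c₀ (N + t) ^ 2 ≤ v ^ 2 := by
      intro t ht
      refine pow_le_pow_left₀ (hg0 _ _) ((hgaxis _ _).trans ?_) 2
      rw [hposq t (Finset.mem_range.1 ht)]
      simp [abs_of_nonneg hv0]
    have h3 := Finset.sum_le_card_nsmul _ _ _ h1
    have h4 := Finset.sum_le_card_nsmul _ _ _ h2
    simp only [Finset.card_range, nsmul_eq_mul] at h3 h4
    have h5 : (M : ℝ) = N * (8 * N + 10) ^ 2 + 2 := by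
      rw [hM, meansMultiplicity]; push_cast; rfl
    have h6 : (M : ℝ) * v ^ 2 ≤ 1 := by
      have : v ≤ 1 := by
        rw [hv, div_le_one hM0]
        rcases hβ01 with h | h <;> rw [h] <;> linarith [show (0 : ℝ) ≤ M by positivity]
      have h7 : (M : ℝ) * v ≤ 1 := by rcases hβ01 with h | h <;> rw [h] at hvM <;> nlinarith
      nlinarith
    linarith
  refine ⟨c₀, ?_, fun c hc => ?_⟩
  · obtain ⟨l, hl⟩ := exists_fin_ne hN i
    have h1 := indexPos_of_lt_bounds (T := N + M) (m := m) (bob := fun _ => 8 * ((i : ℤ) + 1))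
      (pin := meansPin i) (b := b) l.2
    have hv1 : v ≤ 1 := by
      rw [hv, div_le_one hM0]
      rcases hβ01 with h | h <;> rw [h] <;> linarith [show (0 : ℝ) ≤ M by positivity]
    have hli : (l : ℕ) ≠ i := fun h => hl (Fin.ext h)
    refine powCost_indexStream_pos (t := l) (by omega) ?_ fun l' => ?_
    · intro h
      rcases lt_or_gt_of_ne hli with h' | h'
      · have : indexPos (N + M) m (fun _ => 8 * ((i : ℤ) + 1)) (meansPin i) b l + 1
          ≤ 8 * ((i : ℤ) + 1) := by omega
        have h2 : (indexPos (N + M) m (fun _ => 8 * ((i : ℤ) + 1)) (meansPin i) b l : ℝ) + 1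
          ≤ 8 * ((i : ℝ) + 1) := by exact_mod_cast this
        linarith
      · have : 8 * ((i : ℤ) + 1) + 2
          ≤ indexPos (N + M) m (fun _ => 8 * ((i : ℤ) + 1)) (meansPin i) b l := by omega
        have h2 : 8 * ((i : ℝ) + 1) + 2
          ≤ indexPos (N + M) m (fun _ => 8 * ((i : ℤ) + 1)) (meansPin i) b l := by
          exact_mod_cast this
        linarith
    · have h2 : meansPin i l' = 8 * ((i : ℤ) + 1) - 4 + 8 * l' := rfl
      omega
  · simp only [hcost] at hc ⊢
    set u : ℝ := c j₀ - z with hu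
    have hcu : c j₀ = z + u := by rw [hu]; ring
    have hεle : 1 / (16 * ((M : ℝ) + 1)) < 1 := by
      rw [div_lt_one (by positivity)]
      linarith [show (0 : ℝ) ≤ M by positivity]
    -- Otherwise each copy costs at least `1`, in total `M`, whereas the cost of `c₀` is at most `M
    -- - 1` and `ε < 1`; the summand `2` in `meansMultiplicity` provides this margin.
    have hdist : dist (axisPoint j₀ z) c < 1 := by
      by_contra! hcon
      have h1 : ∀ t ∈ Finset.range M, (1 : ℝ) ≤ g c (N + t) ^ 2 := by
        intro t ht
        have h2 : 1 ≤ g c (N + t) := by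
          obtain ⟨-, h | ⟨l, h⟩⟩ := hgcases c (N + t)
          · rw [h, hposq t (Finset.mem_range.1 ht)]; exact hcon
          · rw [h, hposq t (Finset.mem_range.1 ht)]; linarith [(hpinfar l).1]
        nlinarith
      have h2 := Finset.card_nsmul_le_sum _ _ _ h1
      simp only [Finset.card_range, nsmul_eq_mul, mul_one] at h2
      have h3 : 0 ≤ ∑ t ∈ Finset.range N, g c t ^ 2 := Finset.sum_nonneg fun t _ => sq_nonneg _
      linarith
    have hu1 : |u| < 1 := by
      refine lt_of_le_of_lt ?_ hdist
      have := abs_sub_le_dist_axisPoint j₀ z c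
      rwa [abs_sub_comm, ← hu] at this
    have hother : ∀ t < N, t ≠ i → g c₀ t ≤ g c t := by
      intro t ht hti
      have h1 := indexPos_of_lt_bounds (T := N + M) (m := m) (bob := fun _ => 8 * ((i : ℤ) + 1))
        (pin := meansPin i) (b := b) ht
      rw [← hpos] at h1
      obtain ⟨h2, h | ⟨l, h⟩⟩ := hgcases c t
      · rw [h]
        refine le_trans ?_ h2
        rw [abs_lt] at hu1
        rcases lt_or_gt_of_ne hti with h' | h'
        · refine (hgpin c₀ t ⟨0, by omega⟩).trans ?_
          have h3 : pos t - meansPin i 0 ≤ 0 := by unfold meansPin; omega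
          have h4 : (pos t : ℝ) - meansPin i 0 ≤ 0 := by exact_mod_cast h3
          have h5 : ((meansPin i 0 : ℤ) : ℝ) = z - 4 := by
            unfold meansPin; push_cast; rw [hz]; ring
          simp only
          rw [abs_of_nonpos h4]
          refine le_trans ?_ (neg_le_abs _)
          linarith
        · refine (hgpin c₀ t ⟨1, by omega⟩).trans ?_
          have h3 : 0 ≤ pos t - meansPin i 1 := by unfold meansPin; omega
          have h4 : 0 ≤ (pos t : ℝ) - meansPin i 1 := by exact_mod_cast h3
          have h5 : ((meansPin i 1 : ℤ) : ℝ) = z + 4 := by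
            unfold meansPin; push_cast; rw [hz]; ring
          simp only
          rw [abs_of_nonneg h4]
          refine le_trans ?_ (le_abs_self _)
          linarith
      · rw [h]; exact hgpin c₀ t l
    have hown : |β - u| ≤ g c i := by
      obtain ⟨h2, h | ⟨l, h⟩⟩ := hgcases c i
      · rw [h]
        refine le_trans (le_of_eq ?_) h2
        rw [hposi, hcu]; congr 1; ring
      · rw [h, hposi]
        have h3 : |β - u| ≤ 2 := by
          rw [abs_lt] at hu1
          rw [abs_le]
          rcases hβ01 with h | h <;> rw [h] <;> constructor <;> linarith
        obtain ⟨h4, h5⟩ := hpinfar l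
        rcases hβ01 with h | h <;> rw [h] at h3 ⊢
        · rw [add_zero]; linarith
        · linarith
    have hmid : ∀ t < M, |u| ≤ g c (N + t) := by
      intro t ht
      obtain ⟨h2, h | ⟨l, h⟩⟩ := hgcases c (N + t)
      · rw [h]
        refine le_trans (le_of_eq ?_) h2
        rw [hposq t ht, hcu, ← abs_neg]; congr 1; ring
      · rw [h, hposq t ht]
        linarith [(hpinfar l).1]
    have hsum1 : ∑ t ∈ Finset.range N, (g c₀ t ^ 2 +
        (if t = i then (β - u) ^ 2 - (β - v) ^ 2 else 0)) ≤ ∑ t ∈ Finset.range N, g c t ^ 2 := by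
      refine Finset.sum_le_sum fun t ht => ?_
      by_cases hti : t = i
      · rw [if_pos hti, hti]
        have h1 := hgaxis (z + v) i
        rw [hposi, ← hc₀, show z + β - (z + v) = β - v by ring] at h1
        have h2 := pow_le_pow_left₀ (hg0 _ _) h1 2
        have h3 := pow_le_pow_left₀ (abs_nonneg _) hown 2
        rw [sq_abs] at h2 h3
        linarith
      · rw [if_neg hti, add_zero]
        exact pow_le_pow_left₀ (hg0 _ _) (hother t (Finset.mem_range.1 ht) hti) 2
    have hsum2 : ∑ t ∈ Finset.range M, (g c₀ (N + t) ^ 2 + (u ^ 2 - v ^ 2))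
        ≤ ∑ t ∈ Finset.range M, g c (N + t) ^ 2 := by
      refine Finset.sum_le_sum fun t ht => ?_
      have h1 := hgaxis (z + v) (N + t)
      rw [hposq t (Finset.mem_range.1 ht), ← hc₀, show z - (z + v) = -v by ring] at h1
      have h2 := pow_le_pow_left₀ (hg0 _ _) h1 2
      have h3 := pow_le_pow_left₀ (abs_nonneg _) (hmid t (Finset.mem_range.1 ht)) 2
      rw [sq_abs] at h2 h3
      linarith
    rw [Finset.sum_add_distrib, Finset.sum_ite_eq' (Finset.range N) (i : ℕ),
      if_pos (Finset.mem_range.2 hi)] at hsum1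
    rw [Finset.sum_add_distrib, Finset.sum_const, Finset.card_range, nsmul_eq_mul] at hsum2
    -- Since `v` is the mean, the excess cost is an exact square; `ε` is chosen to make `(M + 1) *
    -- |u - v| ≤ 1 / 4`.
    have hid : (β - u) ^ 2 - (β - v) ^ 2 + M * (u ^ 2 - v ^ 2) = (M + 1) * (u - v) ^ 2 := by
      rw [← hvM]; ring
    have hnn : 0 ≤ ((M : ℝ) + 1) * (u - v) ^ 2 := by positivity
    have hle : ((M : ℝ) + 1) * (u - v) ^ 2 ≤ 1 / (16 * (M + 1)) := by linarith
    rw [le_div_iff₀ (by positivity)] at hle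
    have hsq : |(M + 1) * (u - v)| ≤ 1 / 4 := by
      apply abs_le_of_sq_le_sq _ (by norm_num)
      nlinarith
    rw [abs_le] at hsq
    refine ⟨by linarith, hu1.trans (by norm_num), ?_⟩
    rw [div_lt_iff₀ (by positivity)]
    cases hb : b i
    · have hβ0 : β = 0 := by rw [hβ, hb]; simp
      simp only [Bool.false_eq_true, iff_false, not_lt]
      nlinarith
    · have hβ1 : β = 1 := by rw [hβ, hb]; simp
      simp only [iff_true]
      nlinarith

end Gadgets

/-- The arithmetic behind the linear lower bound. -/
theorem linear_bound_of_code_bound {γ : ℝ} (hγ : 0 < γ) {n N s : ℕ} (hn : 16 * (γ + 1) / γ ≤ n)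
    (hN : n ≤ 8 * N + 8) (h : γ * N ≤ s + 1) : γ / 16 * n ≤ s := by
  rw [div_le_iff₀ hγ] at hn
  have : (n : ℝ) ≤ 8 * N + 8 := by exact_mod_cast hN
  nlinarith

theorem mainTheorem6 (δ : ℝ) (hδ0 : 0 < δ) (hδ : δ < 1 / 2) :
    ∃ c : ℝ, 0 < c ∧ ∃ n₀ : ℕ,
      ∀ (d k : ℕ), 1 ≤ d →
      ∀ U : Set (EuclideanSpace ℝ (Fin d)), integerPoints d ⊆ U →
      ∀ (Ω : Type*) [MeasurableSpace Ω] (μ : Measure Ω) [IsProbabilityMeasure μ]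
        (A : StreamingAlgorithm Ω d k),
        (2 ≤ k → A.IsAsymptoticallyExact μ (kMedianCost d k) U δ →
          ∀ n ≥ n₀, ∀ s : ℕ, A.UsesSpaceAtMost μ n s → c * n ≤ s) ∧
        (3 ≤ k → A.IsAsymptoticallyExact μ (kMeansCost d k) U δ →
          ∀ n ≥ n₀, ∀ s : ℕ, A.UsesSpaceAtMost μ n s → c * n ≤ s) := by
  have hlog : 0 < Real.log 2 := Real.log_pos (by norm_num)
  set γ : ℝ := (1 - 2 * δ) ^ 2 / (2 * Real.log 2) with hγdef
  have hγ : 0 < γ := by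
    have : 0 < 1 - 2 * δ := by linarith
    positivity
  have hcode : ∀ {N s : ℕ}, (1 - 2 * δ) ^ 2 * N / 2 ≤ (s + 1) * Real.log 2 → γ * N ≤ s + 1 := by
    intro N s h
    rw [hγdef, div_mul_eq_mul_div, div_le_iff₀ (by positivity)]
    linarith
  refine ⟨γ / 16, by positivity, max 17 ⌈16 * (γ + 1) / γ⌉₊, ?_⟩
  intro d k hd U hU Ω _ μ _ A
  -- `N = (n - 1) / 8` is the largest number of bits whose encoding fits in the grid; `n ≥ 17` gives
  -- `N ≥ 2`, so that some point besides point `i` keeps the cost positive.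
  have hbig : ∀ n ≥ max 17 ⌈16 * (γ + 1) / γ⌉₊, 2 ≤ (n - 1) / 8 ∧ 8 * ((n - 1) / 8) + 1 ≤ n ∧
      n ≤ 8 * ((n - 1) / 8) + 8 ∧ 16 * (γ + 1) / γ ≤ n := by
    intro n hn
    have h1 := (le_max_left _ _).trans hn
    have h2 := (le_max_right _ _).trans hn
    exact ⟨by omega, by omega, by omega, Nat.ceil_le.1 h2⟩
  refine ⟨fun hk hA n hn s hs => ?_, fun hk hA n hn s hs => ?_⟩
  · obtain ⟨m, rfl⟩ : ∃ m, k = m + 1 := ⟨k - 1, by omega⟩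
    obtain ⟨h1, h2, h3, h4⟩ := hbig n hn
    rw [kMedianCost_eq_powCost] at hA
    exact linear_bound_of_code_bound hγ h4 h3 (hcode (A.space_lower_bound one_ne_zero (by omega)
      (fun i => (nonempty_medianGadget (by omega) h1 (⟨0, hd⟩ : Fin d) i).some) hδ hU hA h2 hs))
  · obtain ⟨m, rfl⟩ : ∃ m, k = m + 1 := ⟨k - 1, by omega⟩
    obtain ⟨h1, h2, h3, h4⟩ := hbig n hn
    rw [kMeansCost_eq_powCost] at hA
    exact linear_bound_of_code_bound hγ h4 h3 (hcode (A.space_lower_bound two_ne_zero (by omega)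
      (fun i => (nonempty_meansGadget (by omega) h1 (⟨0, hd⟩ : Fin d) i).some) hδ hU hA h2 hs))
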